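/- Let $d,k$ be natural numbers. A maximally entangled state in $\mathbb{C}^d\otimes\mathbb{C}^d$ is a vector $(U\otimes I)|\Gamma\rangle$ with $U$ unitary and $|\Gamma\rangle=\frac{1}{\sqrt d}\sum_{j=1}^d|jj\rangle$; two such states are orthogonal iff the corresponding unitaries are Hilbert–Schmidt orthogonal. For a set $\mathcal S=\{|\psi_1\rangle,\dots,|\psi_n\rangle\}$ of orthonormal states in $\mathbb{C}^d\otimes\mathbb{C}^d$ and a $k$-element set $T\subseteq\{1,\dots,n\}$, let $$\rho_T=\frac{1}{k!}\sum_{\sigma}|\Psi_\sigma\rangle\langle\Psi_\sigma|,\qquad |\Psi_\sigma\rangle=|\psi_{\sigma(1)}\rangle\otimes\cdots\otimes|\psi_{\sigma(k)}\rangle,$$ where $\sigma$ runs over the $k!$ bijections $\{1,\dots,k\}\to T$, regarded as a bipartite state in which one party holds the first tensor factors and the other party the second tensor factors of all $k$ states. The set $\mathcal S$ is called $(n,k)$-identifiable if there is a measurement $(M_T)_{|T|=k}$ with $\operatorname{Tr}(M_T\rho_T)=1$ for all $T$ that the two parties can implement by local operations and classical communication (LOCC), where finite-round LOCC protocols as well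 as limits of the measurements implemented by such protocols are allowed; otherwise $\mathcal S$ is called $(n,k)$-unidentifiable. (1) If $\mathcal S$ is an orthonormal basis of $\mathbb{C}^d\otimes\mathbb{C}^d$ consisting of $d^2$ maximally entangled states and $\binom{d^2}{k}>d^k$, then $\mathcal S$ is $(d^2,k)$-unidentifiable. (2) More generally, if $\mathcal S$ is any set of $D$ pairwise orthogonal maximally entangled states in $\mathbb{C}^d\otimes\mathbb{C}^d$ and $\binom{D}{k}>d^k$, then $\mathcal S$ is $(D,k)$-unidentifiable. -/

import Mathlib

open scoped Kronecker

namespace LocalSubset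

/-- Measurements on `ℂ^A ⊗ ℂ^B` (families of effects `M i`, one for each answer `i : κ`) that two
parties can perform by a finite protocol of local operations and classical communication.

A protocol either stops with an answer, or one of the parties performs a local quantum operation
with Kraus operators `K x` (`∑ x, K x ᴴ * K x = 1`) from its system to a system of arbitrary
dimension `n x`, tells the result `x` to the other party, and they go on with a protocol that
may depend on `x`. The effects are those of the whole protocol, pulled back to the initial system.
Local ancillas, local randomness and operations with several Kraus operators per message
are included: the continuation is free to ignore (part of) `x`. -/
inductive IsFiniteLOCC {κ : Type} [DecidableEq κ] :
    ∀ {A B : Type}, (κ → Matrix (A × B) (A × B) ℂ) → Prop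
  | halt {A B : Type} [DecidableEq A] [DecidableEq B] (answer : κ) :
      IsFiniteLOCC (fun i => if i = answer then (1 : Matrix (A × B) (A × B) ℂ) else 0)
  | alice {A B : Type} [Fintype A] [DecidableEq A] [Fintype B] [DecidableEq B]
      {r : ℕ} {n : Fin r → ℕ} (K : ∀ x, Matrix (Fin (n x)) A ℂ)
      (hK : ∑ x, (K x).conjTranspose * K x = 1)
      (M : ∀ x, κ → Matrix (Fin (n x) × B) (Fin (n x) × B) ℂ)
      (hM : ∀ x, IsFiniteLOCC (M x)) :
      IsFiniteLOCC (fun i => ∑ x,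
        (K x ⊗ₖ (1 : Matrix B B ℂ)).conjTranspose * M x i * (K x ⊗ₖ (1 : Matrix B B ℂ)))
  | bob {A B : Type} [Fintype A] [DecidableEq A] [Fintype B] [DecidableEq B]
      {r : ℕ} {n : Fin r → ℕ} (K : ∀ x, Matrix (Fin (n x)) B ℂ)
      (hK : ∑ x, (K x).conjTranspose * K x = 1)
      (M : ∀ x, κ → Matrix (A × Fin (n x)) (A × Fin (n x)) ℂ)
      (hM : ∀ x, IsFiniteLOCC (M x)) :
      IsFiniteLOCC (fun i => ∑ x,
        ((1 : Matrix A A ℂ) ⊗ₖ K x).conjTranspose * M x i * ((1 : Matrix A A ℂ) ⊗ₖ K x))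

/-- LOCC measurements, in the widest sense: finite LOCC protocols together with all limits of them.
This contains in particular the protocols with an unbounded number of rounds or with
countably many messages. -/
def IsLOCC {κ A B : Type} [DecidableEq κ] (M : κ → Matrix (A × B) (A × B) ℂ) : Prop :=
  M ∈ closure {M' : κ → Matrix (A × B) (A × B) ℂ | IsFiniteLOCC M'}

/-- A family of mixed states of `ℂ^A ⊗ ℂ^B` is perfectly distinguishable by LOCC: some LOCC
measurement gives the answer `i` with probability one on the state `ρ i`, for all `i`. -/
def IsLocallyDistinguishable {κ A B : Type} [DecidableEq κ] [Fintype A] [Fintype B]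
    (ρ : κ → Matrix (A × B) (A × B) ℂ) : Prop :=
  ∃ M : κ → Matrix (A × B) (A × B) ℂ, IsLOCC M ∧ ∀ i, (M i * ρ i).trace = 1

/-- The product `ψ (f 0) ⊗ ⋯ ⊗ ψ (f (k-1))` of bipartite states, as a bipartite state: the first
party holds the first factor of each of the `k` states, the second party the second factors. -/
noncomputable def tupleState {ι A B : Type} {k : ℕ} (ψ : ι → EuclideanSpace ℂ (A × B))
    (f : Fin k → ι) : (Fin k → A) × (Fin k → B) → ℂ :=
  fun p => ∏ j, ψ (f j) (p.1 j, p.2 j)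

/-- The mixed state shared by the parties if the states `ψ i`, `i ∈ T`, are distributed in a
uniformly random order, where `T` has `k` elements. -/
noncomputable def subsetState {ι A B : Type} [DecidableEq ι] {k : ℕ}
    (ψ : ι → EuclideanSpace ℂ (A × B)) (T : {T : Finset ι // T.card = k}) :
    Matrix ((Fin k → A) × (Fin k → B)) ((Fin k → A) × (Fin k → B)) ℂ :=
  ((k.factorial : ℂ)⁻¹) • ∑ σ : Fin k ≃ {i // i ∈ T.1},
    Matrix.vecMulVec (tupleState ψ (fun j => (σ j).1)) (star (tupleState ψ (fun j => (σ j).1)))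

/-- `(n, k)`-identifiability of a family of `n` bipartite states `ψ`: the `k`-element subsets can be
perfectly identified (without the order of their elements) by LOCC. -/
def IsLocallyIdentifiable {ι A B : Type} [DecidableEq ι] [Fintype A] [Fintype B]
    (ψ : ι → EuclideanSpace ℂ (A × B)) (k : ℕ) : Prop :=
  IsLocallyDistinguishable (fun T : {T : Finset ι // T.card = k} => subsetState ψ T)

/-- `(n, k)`-unidentifiability. -/
def IsLocallyUnidentifiable {ι A B : Type} [DecidableEq ι] [Fintype A] [Fintype B]
    (ψ : ι → EuclideanSpace ℂ (A × B)) (k : ℕ) : Prop :=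
  ¬ IsLocallyIdentifiable ψ k

/-- The vector `(1/√d) ∑ j, |j j⟩` of `ℂ^d ⊗ ℂ^d`. -/
noncomputable def Gam (d : ℕ) : Fin d × Fin d → ℂ :=
  fun p => if p.1 = p.2 then ((Real.sqrt d : ℝ) : ℂ)⁻¹ else 0

/-- Maximally entangled states of `ℂ^d ⊗ ℂ^d`: the vectors `(U ⊗ 1) Γ` with `U` unitary. -/
def IsMaximallyEntangled {d : ℕ} (ψ : EuclideanSpace ℂ (Fin d × Fin d)) : Prop :=
  ∃ U ∈ Matrix.unitaryGroup (Fin d) ℂ,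
    ψ = WithLp.toLp 2 ((U ⊗ₖ (1 : Matrix (Fin d) (Fin d) ℂ)).mulVec (Gam d))

end LocalSubset

/-! Every LOCC effect has a positive partial transpose (`IsFiniteLOCC.posSemidef_partialTranspose`).
The partial transpose of an unnormalised maximally entangled projector is a swap `F` conjugated by a
local unitary, so `F ≤ 1`, and a PPT effect `M` has expectation at most `Tr M` in such a vector
(`re_trace_mul_vecMulVec_le_of_partialTranspose`). A product of `k` maximally entangled states is
again maximally entangled, with local dimension `d ^ k`; normalising gives `Tr (M_T ρ_T) ≤ d ^ (-k)
Tr M_T`. The effects sum to the identity, of trace `d ^ (2k)`, so the success probabilities sum to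
at most `d ^ k`. Perfect identification would make this sum the number of `k`-subsets. -/

namespace LocalSubset

open Matrix
open scoped ComplexOrder

/-- The partial transpose on the second tensor factor. -/
def partialTranspose {A B : Type} (M : Matrix (A × B) (A × B) ℂ) : Matrix (A × B) (A × B) ℂ :=
  Matrix.of fun p q => M (p.1, q.2) (q.1, p.2)

theorem partialTranspose_one {A B : Type} [DecidableEq A] [DecidableEq B] :
    partialTranspose (1 : Matrix (A × B) (A × B) ℂ) = 1 := by
  ext ⟨a, b⟩ ⟨a', b'⟩
  simp only [partialTranspose, of_apply, one_apply, Prod.mk.injEq]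
  grind

theorem partialTranspose_sum {A B : Type} {α : Type*} (s : Finset α)
    (M : α → Matrix (A × B) (A × B) ℂ) :
    partialTranspose (∑ x ∈ s, M x) = ∑ x ∈ s, partialTranspose (M x) := by
  ext p q
  simp [partialTranspose, Matrix.sum_apply]

theorem trace_partialTranspose {A B : Type} [Fintype A] [Fintype B]
    (M : Matrix (A × B) (A × B) ℂ) : (partialTranspose M).trace = M.trace := by
  simp [Matrix.trace, partialTranspose]

theorem partialTranspose_kronecker_one_conj {A A' B : Type} [Fintype A'] [Fintype B]
    [DecidableEq B] (K : Matrix A' A ℂ) (M : Matrix (A' × B) (A' × B) ℂ) :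
    partialTranspose ((K ⊗ₖ (1 : Matrix B B ℂ))ᴴ * M * (K ⊗ₖ (1 : Matrix B B ℂ))) =
      (K ⊗ₖ (1 : Matrix B B ℂ))ᴴ * partialTranspose M * (K ⊗ₖ (1 : Matrix B B ℂ)) := by
  ext ⟨a, b⟩ ⟨a', b'⟩
  simp [partialTranspose, Matrix.mul_apply, Fintype.sum_prod_type, one_apply, apply_ite]

/-- On the second factor, `(Kᴴ Y K)ᵀ = Kᵀ Yᵀ K̄`, which is conjugation of `Yᵀ` by the entrywise
conjugate `K̄`. Hence Bob's operations also preserve positivity of the partial transpose. -/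
theorem partialTranspose_one_kronecker_conj {A B B' : Type} [Fintype A] [Fintype B']
    [DecidableEq A] (K : Matrix B' B ℂ) (M : Matrix (A × B') (A × B') ℂ) :
    partialTranspose (((1 : Matrix A A ℂ) ⊗ₖ K)ᴴ * M * ((1 : Matrix A A ℂ) ⊗ₖ K)) =
      ((1 : Matrix A A ℂ) ⊗ₖ K.map star)ᴴ * partialTranspose M *
        ((1 : Matrix A A ℂ) ⊗ₖ K.map star) := by
  ext ⟨a, b⟩ ⟨a', b'⟩
  simp only [partialTranspose, Matrix.mul_apply, Fintype.sum_prod_type, one_apply, of_apply,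
    conjTranspose_apply, kronecker_apply, map_apply]
  simp [apply_ite, Finset.sum_mul]
  rw [Finset.sum_comm]
  refine Finset.sum_congr rfl fun x _ => Finset.sum_congr rfl fun y _ => ?_
  ring

/-- The effects of a finite LOCC measurement have a positive partial transpose. -/
theorem IsFiniteLOCC.posSemidef_partialTranspose {κ : Type} [DecidableEq κ] {A B : Type}
    {M : κ → Matrix (A × B) (A × B) ℂ} (h : IsFiniteLOCC M) (i : κ) :
    (partialTranspose (M i)).PosSemidef := by
  induction h with
  | halt answer =>
    dsimp only
    split_ifs
    · rw [partialTranspose_one]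
      exact PosSemidef.one
    · exact PosSemidef.zero
  | alice K hK M hM ih =>
    rw [partialTranspose_sum]
    refine posSemidef_sum _ fun x _ => ?_
    rw [partialTranspose_kronecker_one_conj]
    exact (ih x).conjTranspose_mul_mul_same _
  | bob K hK M hM ih =>
    rw [partialTranspose_sum]
    refine posSemidef_sum _ fun x _ => ?_
    rw [partialTranspose_one_kronecker_conj]
    exact (ih x).conjTranspose_mul_mul_same _

theorem sum_kronecker {α : Type*} {l m n p : Type} (s : Finset α) (K : α → Matrix l m ℂ)
    (L : Matrix n p ℂ) : (∑ x ∈ s, K x) ⊗ₖ L = ∑ x ∈ s, K x ⊗ₖ L := by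
  ext a b
  simp [Matrix.sum_apply, Finset.sum_mul]

theorem kronecker_sum {α : Type*} {l m n p : Type} (s : Finset α) (K : Matrix l m ℂ)
    (L : α → Matrix n p ℂ) : K ⊗ₖ (∑ x ∈ s, L x) = ∑ x ∈ s, K ⊗ₖ L x := by
  ext a b
  simp [Matrix.sum_apply, Finset.mul_sum]

/-- The effects of a finite LOCC measurement add up to the identity. -/
theorem IsFiniteLOCC.sum_eq_one {κ : Type} [DecidableEq κ] [Fintype κ] {A B : Type}
    [inst : DecidableEq (A × B)] {M : κ → Matrix (A × B) (A × B) ℂ} (h : IsFiniteLOCC M) :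
    ∑ i, M i = 1 := by
  -- Generalising over the instance lets the induction hypothesis apply whichever decidability
  -- instance occurs in the identity matrix.
  revert inst
  induction h with
  | halt answer =>
    intro inst
    rw [Finset.sum_ite_eq' Finset.univ answer, if_pos (Finset.mem_univ _)]
    congr!
  | alice K hK M hM ih =>
    intro inst
    rw [Finset.sum_comm]
    simp only [← Matrix.sum_mul, ← Matrix.mul_sum, ih, Matrix.mul_one]
    simp only [conjTranspose_kronecker, ← mul_kronecker_mul, conjTranspose_one, Matrix.mul_one]
    rw [← sum_kronecker, hK, one_kronecker_one]
    congr!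
  | bob K hK M hM ih =>
    intro inst
    rw [Finset.sum_comm]
    simp only [← Matrix.sum_mul, ← Matrix.mul_sum, ih, Matrix.mul_one]
    simp only [conjTranspose_kronecker, ← mul_kronecker_mul, conjTranspose_one, Matrix.mul_one]
    rw [← kronecker_sum, hK, one_kronecker_one]
    congr!

/-- A matrix with positive partial transpose has expectation at most its trace in the unnormalised
maximally entangled vector given by the entries of a unitary matrix. -/
theorem re_trace_mul_vecMulVec_le_of_partialTranspose {I : Type} [Fintype I] [DecidableEq I]
    {M : Matrix (I × I) (I × I) ℂ} (hM : (partialTranspose M).PosSemidef)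
    {W : Matrix I I ℂ} (hW : W ∈ unitaryGroup I ℂ) :
    (M * vecMulVec (fun p : I × I => W p.1 p.2) (star fun p : I × I => W p.1 p.2)).trace.re ≤ M.trace.re := by
  -- `F` is the partial transpose of the projector onto `W`, that is `(W ⊗ 1) SWAP (W ⊗ 1)ᴴ`: a
  -- Hermitian involution.
  let F : Matrix (I × I) (I × I) ℂ := Matrix.of fun p q => star (W q.1 p.2) * W p.1 q.2
  have hF : Fᴴ = F := by
    ext p q
    simp [F, mul_comm]
  have hFF : F * F = 1 := by
    ext ⟨a, b⟩ ⟨a', b'⟩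
    have h1 := congrFun (congrFun (mem_unitaryGroup_iff.1 hW) a) a'
    have h2 := congrFun (congrFun (mem_unitaryGroup_iff'.1 hW) b) b'
    simp only [Matrix.mul_apply, star_apply] at h1 h2
    have h3 : (F * F) (a, b) (a', b') =
        (∑ j, W a j * star (W a' j)) * ∑ j, star (W j b) * W j b' := by
      simp only [F, Matrix.mul_apply, Fintype.sum_prod_type, of_apply, Finset.sum_mul_sum]
      rw [Finset.sum_comm]
      refine Finset.sum_congr rfl fun x _ => Finset.sum_congr rfl fun y _ => ?_
      ring
    rw [h3, h1, h2]
    simp only [one_apply, Prod.mk.injEq]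
    grind
  have hpos : 0 ≤ ((1 - F)ᴴ * partialTranspose M * (1 - F)).trace :=
    (hM.conjTranspose_mul_mul_same (1 - F)).trace_nonneg
  -- This exhibits `1 - F` as positive, so pairing it with the partial transpose of `M` gives a
  -- nonnegative trace.
  have hsq : (1 - F) * (1 - F)ᴴ = 2 • (1 - F) := by
    rw [conjTranspose_sub, conjTranspose_one, hF, sub_mul, mul_sub, mul_sub, hFF]
    simp only [Matrix.one_mul, Matrix.mul_one]
    abel
  rw [Matrix.mul_assoc, Matrix.trace_mul_comm, Matrix.mul_assoc, hsq, Matrix.mul_smul,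
    Matrix.mul_sub, Matrix.mul_one, Matrix.trace_smul, Matrix.trace_sub,
    trace_partialTranspose] at hpos
  -- Partial transposition can be moved from one factor to the other under the trace.
  have hswap : (partialTranspose M * F).trace =
      (M * vecMulVec (fun p : I × I => W p.1 p.2) (star fun p : I × I => W p.1 p.2)).trace := by
    simp only [Matrix.trace, diag_apply, Matrix.mul_apply, partialTranspose, of_apply, F,
      vecMulVec_apply, Pi.star_apply, Fintype.sum_prod_type]
    refine Finset.sum_congr rfl fun a _ => ?_
    rw [Finset.sum_comm' (t' := Finset.univ) (s' := fun _ => Finset.univ) (by simp)]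
    conv_rhs => rw [Finset.sum_comm]
    refine Finset.sum_congr rfl fun x _ => ?_
    rw [Finset.sum_comm]
    refine Finset.sum_congr rfl fun y _ => Finset.sum_congr rfl fun z _ => ?_
    ring
  rw [hswap] at hpos
  have := (Complex.le_def.1 hpos).1
  simp at this
  linarith

/-- The entrywise description of a tensor product of unitary matrices is unitary. -/
theorem pi_prod_mem_unitaryGroup {I J : Type} [Fintype I] [DecidableEq I] [Fintype J]
    [DecidableEq J] {U : J → Matrix I I ℂ} (hU : ∀ j, U j ∈ unitaryGroup I ℂ) :
    (Matrix.of fun a b : J → I => ∏ j, U j (a j) (b j)) ∈ unitaryGroup (J → I) ℂ := by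
  rw [mem_unitaryGroup_iff]
  ext a b
  have h (j : J) : ∑ x, U j (a j) x * star (U j (b j) x) = if a j = b j then 1 else 0 := by
    have := congrFun (congrFun (mem_unitaryGroup_iff.1 (hU j)) (a j)) (b j)
    simpa only [Matrix.mul_apply, star_apply, one_apply] using this
  simp only [Matrix.mul_apply, star_apply, of_apply, star_prod, ← Finset.prod_mul_distrib]
  rw [← Fintype.prod_sum (f := fun j x => U j (a j) x * star (U j (b j) x)),
    Finset.prod_congr rfl fun j _ => h j]
  by_cases hab : a = b
  · simp [hab, one_apply]
  · obtain ⟨j, hj⟩ := Function.ne_iff.1 hab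
    rw [one_apply_ne hab]
    exact Finset.prod_eq_zero (Finset.mem_univ j) (if_neg hj)

theorem IsMaximallyEntangled.exists_unitary_apply {d : ℕ}
    {ψ : EuclideanSpace ℂ (Fin d × Fin d)} (h : IsMaximallyEntangled ψ) :
    ∃ U ∈ unitaryGroup (Fin d) ℂ, ∀ p, ψ p = ((√d : ℝ) : ℂ)⁻¹ * U p.1 p.2 := by
  obtain ⟨U, hU, rfl⟩ := h
  refine ⟨U, hU, fun p => ?_⟩
  simp [mulVec, dotProduct, Gam, Fintype.sum_prod_type, one_apply, mul_comm]

/-- Regrouping the factors by party turns the product state into the one given by the tensor product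
of the unitaries. -/
theorem exists_unitary_tupleState {ι : Type} {d k : ℕ} {ψ : ι → EuclideanSpace ℂ (Fin d × Fin d)}
    (hψ : ∀ l, IsMaximallyEntangled (ψ l)) (f : Fin k → ι) :
    ∃ W ∈ unitaryGroup (Fin k → Fin d) ℂ,
      tupleState ψ f = ((√d : ℝ) : ℂ)⁻¹ ^ k • fun p => W p.1 p.2 := by
  choose U hU hUψ using fun l => (hψ l).exists_unitary_apply
  refine ⟨_, pi_prod_mem_unitaryGroup fun j => hU (f j), ?_⟩
  ext p
  simp [tupleState, hUψ, Finset.prod_mul_distrib]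

theorem re_trace_mul_tupleState_le {ι : Type} {d k : ℕ}
    {ψ : ι → EuclideanSpace ℂ (Fin d × Fin d)} (hψ : ∀ l, IsMaximallyEntangled (ψ l))
    {M : Matrix ((Fin k → Fin d) × (Fin k → Fin d)) ((Fin k → Fin d) × (Fin k → Fin d)) ℂ}
    (hM : (partialTranspose M).PosSemidef) (f : Fin k → ι) :
    (M * vecMulVec (tupleState ψ f) (star (tupleState ψ f))).trace.re ≤
      ((d : ℝ) ^ k)⁻¹ * M.trace.re := by
  obtain ⟨W, hW, h⟩ := exists_unitary_tupleState hψ f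
  have hc : ((√d : ℝ) : ℂ)⁻¹ ^ k * star (((√d : ℝ) : ℂ)⁻¹ ^ k) = (((d : ℝ) ^ k)⁻¹ : ℝ) := by
    rw [star_pow, ← mul_pow, star_inv₀, Complex.star_def, Complex.conj_ofReal, ← mul_inv,
      ← Complex.ofReal_mul, Real.mul_self_sqrt (Nat.cast_nonneg d)]
    push_cast
    rw [inv_pow]
  rw [h, star_smul, smul_vecMulVec, vecMulVec_smul, smul_smul, hc, Matrix.mul_smul,
    Matrix.trace_smul, smul_eq_mul, Complex.re_ofReal_mul]
  exact mul_le_mul_of_nonneg_left (re_trace_mul_vecMulVec_le_of_partialTranspose hM hW)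
    (by positivity)

/-- An effect with positive partial transpose detects a random arrangement of `k` maximally
entangled states with probability at most `d ^ (-k)` times its trace. -/
theorem re_trace_mul_subsetState_le {ι : Type} [DecidableEq ι] {d k : ℕ}
    {ψ : ι → EuclideanSpace ℂ (Fin d × Fin d)} (hψ : ∀ l, IsMaximallyEntangled (ψ l))
    {M : Matrix ((Fin k → Fin d) × (Fin k → Fin d)) ((Fin k → Fin d) × (Fin k → Fin d)) ℂ}
    (hM : (partialTranspose M).PosSemidef) (T : {T : Finset ι // T.card = k}) :
    (M * subsetState ψ T).trace.re ≤ ((d : ℝ) ^ k)⁻¹ * M.trace.re := by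
  have hcard : Fintype.card (Fin k ≃ {i // i ∈ T.1}) = k.factorial := by
    rw [Fintype.card_equiv (Fintype.equivOfCardEq (by simp [T.2])), Fintype.card_fin]
  have hfac : (0 : ℝ) < k.factorial := by positivity
  have hcast : ((k.factorial : ℂ)⁻¹) = (((k.factorial : ℝ)⁻¹ : ℝ) : ℂ) := by push_cast; rfl
  rw [subsetState, Matrix.mul_smul, Matrix.trace_smul, smul_eq_mul, hcast, Complex.re_ofReal_mul,
    Finset.mul_sum, Matrix.trace_sum, Complex.re_sum, inv_mul_le_iff₀ hfac]
  refine (Finset.sum_le_sum fun σ _ => re_trace_mul_tupleState_le hψ hM _).trans_eq ?_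
  rw [Finset.sum_const, Finset.card_univ, hcard, nsmul_eq_mul]

/-- The success probabilities of an LOCC measurement for identifying `k`-element subsets of a family
of maximally entangled states add up to at most `d ^ k`. -/
theorem IsLOCC.sum_re_trace_mul_subsetState_le {ι : Type} [DecidableEq ι] [Fintype ι] {d k : ℕ}
    {ψ : ι → EuclideanSpace ℂ (Fin d × Fin d)} (hψ : ∀ l, IsMaximallyEntangled (ψ l))
    {M : {T : Finset ι // T.card = k} →
      Matrix ((Fin k → Fin d) × (Fin k → Fin d)) ((Fin k → Fin d) × (Fin k → Fin d)) ℂ}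
    (hM : IsLOCC M) : ∑ T, (M T * subsetState ψ T).trace.re ≤ (d : ℝ) ^ k := by
  let S : Set ({T : Finset ι // T.card = k} →
      Matrix ((Fin k → Fin d) × (Fin k → Fin d)) ((Fin k → Fin d) × (Fin k → Fin d)) ℂ) :=
    {M | ∑ T, (M T * subsetState ψ T).trace.re ≤ (d : ℝ) ^ k}
  -- The bound is a closed condition, so it passes from finite protocols to their limits.
  have hS : IsClosed S := by
    refine isClosed_le (continuous_finsetSum _ fun T _ => Complex.continuous_re.comp ?_)
      continuous_const
    exact ((continuous_apply T).matrix_mul continuous_const).matrix_trace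
  refine closure_minimal (t := S) (fun N hN => ?_) hS hM
  calc ∑ T, (N T * subsetState ψ T).trace.re
      ≤ ∑ T, ((d : ℝ) ^ k)⁻¹ * (N T).trace.re :=
        Finset.sum_le_sum fun T _ =>
          re_trace_mul_subsetState_le hψ (hN.posSemidef_partialTranspose T) T
    _ = ((d : ℝ) ^ k)⁻¹ * (∑ T, N T).trace.re := by
        rw [Matrix.trace_sum, Complex.re_sum, Finset.mul_sum]
    _ = (d : ℝ) ^ k := by
        rw [hN.sum_eq_one, Matrix.trace_one, Complex.natCast_re]
        simp only [Fintype.card_prod, Fintype.card_pi, Fintype.card_fin, Finset.prod_const,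
          Finset.card_univ, Nat.cast_mul, Nat.cast_pow]
        rw [← mul_assoc]
        -- This identity also holds at zero, so `d = 0` needs no separate case.
        exact inv_mul_mul_self _

/-- A family of maximally entangled states of `ℂ^d ⊗ ℂ^d` with more than `d ^ k` subsets of size
`k` is unidentifiable. -/
theorem isLocallyUnidentifiable_of_pow_lt_choose {ι : Type} [DecidableEq ι] [Fintype ι] {d k : ℕ}
    {ψ : ι → EuclideanSpace ℂ (Fin d × Fin d)} (hψ : ∀ l, IsMaximallyEntangled (ψ l))
    (h : d ^ k < (Fintype.card ι).choose k) : IsLocallyUnidentifiable ψ k := by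
  rintro ⟨M, hM, hρ⟩
  have hle := hM.sum_re_trace_mul_subsetState_le hψ
  simp only [hρ, Complex.one_re, Finset.sum_const, Finset.card_univ, Fintype.card_finset_len,
    nsmul_eq_mul, mul_one] at hle
  exact h.not_ge (by exact_mod_cast hle)

end LocalSubset

theorem mainTheorem2 (d k : ℕ) :
    (∀ b : OrthonormalBasis (Fin (d ^ 2)) ℂ (EuclideanSpace ℂ (Fin d × Fin d)),
      (∀ l, LocalSubset.IsMaximallyEntangled (b l)) →
      d ^ k < (d ^ 2).choose k →
      LocalSubset.IsLocallyUnidentifiable (fun l => b l) k) ∧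
    (∀ (D : ℕ) (ψ : Fin D → EuclideanSpace ℂ (Fin d × Fin d)),
      Orthonormal ℂ ψ →
      (∀ l, LocalSubset.IsMaximallyEntangled (ψ l)) →
      d ^ k < D.choose k →
      LocalSubset.IsLocallyUnidentifiable ψ k) := by
  refine ⟨fun b hb h => ?_, fun D ψ _ hψ h => ?_⟩
  · exact LocalSubset.isLocallyUnidentifiable_of_pow_lt_choose hb (by simpa using h)
  · exact LocalSubset.isLocallyUnidentifiable_of_pow_lt_choose hψ (by simpa using h)
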